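/- There is an absolute constant $C>0$ such that the following holds. Let $p$ be a prime, let $A,\Gamma\subseteq\mathbb{F}_p^*$ be multiplicative subgroups with $|\Gamma|\ge p^{3/4}$, and let $\xi\in\mathbb{F}_p^*=\mathbb{F}_p\setminus\{0\}$. All logarithms are to base $2$. (i) If $\Gamma\ne\mathbb{F}_p^*$ and $A-A\subseteq \xi\Gamma\sqcup\{0\}$, then $$|A|\le C\,\min\left\{\frac{|\Gamma|\,\log^{1/2}p}{\sqrt p},\ \sqrt p\right\}.$$ (ii) If $2\le |A|<\sqrt p$, and $A'\subseteq A+s$ for some $s\in\mathbb{F}_p$ is any set with $A'-A'\subseteq\xi\Gamma\sqcup\{0\}$, then $$|A'|^6\le C\,\frac{|A|^4\,\log|A|\cdot|\Gamma|^2}{p}.$$ (Here $A-A\subseteq\xi\Gamma\sqcup\{0\}$ is not assumed.) -/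

import Mathlib

open scoped Pointwise

/-- A multiplicative subgroup of the units of `ZMod p`, viewed as a set of elements of `ZMod p`. -/
def subgroupSet {p : ℕ} (H : Subgroup (ZMod p)ˣ) : Set (ZMod p) :=
  (fun u : (ZMod p)ˣ => (u : ZMod p)) '' (H : Set (ZMod p)ˣ)

/-- `S - S ⊆ ξ Γ ⊔ {0}` (the union is disjoint, since `ξ Γ` consists of units when `p` is prime). -/
def DiffSubset {p : ℕ} (S : Set (ZMod p)) (ξ : (ZMod p)ˣ) (Γ : Subgroup (ZMod p)ˣ) : Prop :=
  S - S ⊆ (ξ : ZMod p) • subgroupSet Γ ∪ {0}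

/-! Let n = |A| and let B be A' shifted back into A. For distinct a, b, c in B the ratio (b - a)/(c
- a) lies in R = Γ ∩ (1 - Γ), because ratios of differences cancel ξ. Cauchy–Schwarz over the values
of this ratio bounds |B|^6, up to a constant, by |R| times the number of pairs of triples with equal
ratio. Such a pair is related by an affine map of nonzero slope, so it is a collinear triple in the
grid of n-th roots of unity. The two factors are bounded separately. A second-moment count of
incidences gives |R| ≤ |Γ|²/p + √p, and |Γ| ≥ p^{3/4} makes the first term dominate
(`card_unitSums_le`). The collinear triples number O(n⁴ log n): a line y = λx + μ with λμ ≠ 0 is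
rescaled to the equations u^n = κ₁, (1 - u)^n = κ₂, and Stepanov's method shows that only O(n²/t³)
classes κ have at least t solutions (`card_level_mul_cube_le`). In part (i), the bound √p is a
pigeonhole argument (`ncard_sq_le_of_diffSubset`); since p is not a square the inequality is strict,
so the estimate of part (ii) applies with A' = A. -/

/-! ### Stepanov's method for u^n = y, (1 - u)^n = z -/

open Polynomial in
/-- In characteristic `p`, a polynomial of degree `< p` with at most `n` terms that vanishes to order
`n` at `1` is zero. -/
theorem eq_zero_of_X_sub_one_pow_dvd {p : ℕ} [Fact p.Prime] (n : ℕ) (P : (ZMod p)[X])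
    (hsupp : P.support.card ≤ n) (hdeg : ∀ e ∈ P.support, e < p) (hdvd : (X - 1) ^ n ∣ P) :
    P = 0 := by
  induction n generalizing P with
  | zero => simpa using hsupp
  | succ n ih =>
    by_contra hP
    obtain ⟨e₀, he₀⟩ := Polynomial.nonempty_support_iff.2 hP
    -- The operator X d/dX - e₀ kills the term of exponent e₀ and lowers the order of vanishing at 1
    -- by at most one, so the induction hypothesis applies to the image.
    have hcoeff : ∀ e : ℕ, (X * derivative P - C (e₀ : ZMod p) * P).coeff e
        = ((e : ZMod p) - e₀) * P.coeff e := by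
      intro e
      cases e with
      | zero => simp
      | succ e => simp [coeff_X_mul, coeff_derivative]; ring
    have hsub : (X * derivative P - C (e₀ : ZMod p) * P).support ⊆ P.support.erase e₀ := by
      intro e he
      rw [mem_support_iff, hcoeff] at he
      rw [Finset.mem_erase, mem_support_iff]
      refine ⟨?_, right_ne_zero_of_mul he⟩
      rintro rfl
      simp at he
    have hzero : X * derivative P - C (e₀ : ZMod p) * P = 0 := by
      apply ih
      · have := Finset.card_le_card hsub
        rw [Finset.card_erase_of_mem he₀] at this
        omega
      · exact fun e he => hdeg e (Finset.mem_of_mem_erase (hsub he))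
      · refine dvd_sub (Dvd.dvd.mul_left ?_ _) (Dvd.dvd.mul_left ((pow_dvd_pow _ n.le_succ).trans hdvd) _)
        obtain ⟨Q, rfl⟩ := hdvd
        rw [derivative_mul, derivative_pow]
        refine dvd_add (Dvd.dvd.mul_right ?_ _) (Dvd.dvd.mul_right (pow_dvd_pow _ n.le_succ) _)
        simp only [Nat.add_sub_cancel]
        exact Dvd.dvd.mul_right (Dvd.intro_left _ rfl) _
    -- Exponents below p that agree mod p are equal, so only e₀ survives; a nonzero monomial does
    -- not vanish at 1.
    have hmono : P = monomial e₀ (P.coeff e₀) := by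
      ext e
      rw [coeff_monomial]
      split_ifs with h
      · rw [h]
      · by_contra hne
        have h1 := hcoeff e
        rw [hzero, coeff_zero, eq_comm, mul_eq_zero, or_iff_left hne, sub_eq_zero,
          ZMod.natCast_eq_natCast_iff'] at h1
        rw [Nat.mod_eq_of_lt (hdeg e (mem_support_iff.2 hne)), Nat.mod_eq_of_lt (hdeg _ he₀)] at h1
        exact h h1.symm
    have h1 : P.eval 1 = 0 := by
      obtain ⟨Q, rfl⟩ := hdvd
      simp
    rw [hmono, eval_monomial] at h1
    exact mem_support_iff.1 he₀ (by simpa using h1)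

-- Reducing the relation modulo W forces W ∣ P 0, hence P 0 = 0; cancel one factor W and repeat.
-- This is uniqueness of a W-adic expansion whose digits are merely never nonzero multiples of W.
open Polynomial in
theorem eq_zero_of_sum_pow_mul_eq_zero {K : Type*} [Field K] (W : K[X]) (hW : W ≠ 0) (b : ℕ)
    (P : ℕ → K[X]) (hP : ∀ l < b, W ∣ P l → P l = 0)
    (hsum : ∑ l ∈ Finset.range b, W ^ l * P l = 0) : ∀ l < b, P l = 0 := by
  induction b generalizing P with
  | zero => simp
  | succ b ih =>
    have hsplit : W * ∑ l ∈ Finset.range b, W ^ l * P (l + 1) + P 0 = 0 := by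
      rw [← hsum, Finset.sum_range_succ', Finset.mul_sum]
      simp [pow_succ', mul_assoc]
    have h0 : P 0 = 0 := hP 0 (by omega) ⟨-∑ l ∈ Finset.range b, W ^ l * P (l + 1), by
      linear_combination hsplit⟩
    rw [h0, add_zero] at hsplit
    have := ih (fun l => P (l + 1)) (fun l hl => hP (l + 1) (by omega))
      ((mul_eq_zero.1 hsplit).resolve_left hW)
    intro l hl
    cases l with
    | zero => exact h0
    | succ l => exact this l (by omega)

open Polynomial in
/-- The auxiliary polynomial of Stepanov's method. -/
noncomputable def stepanovPoly {K : Type*} [Field K] (n a b : ℕ) (c : Fin a × Fin b × Fin b → K) :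
    K[X] :=
  ∑ x, C (c x) * (X ^ (x.1 : ℕ) * (X ^ (n * x.2.1) * (1 - X) ^ (n * x.2.2)))

-- Expand in powers of (1 - X)^n. Each digit has at most a * b ≤ n terms and degree below n * b ≤ p,
-- so it cannot be a nonzero multiple of (1 - X)^n. Its exponents i + n j are distinct because i <
-- n, so zero digits mean zero coefficients c.
open Polynomial in
theorem stepanovPoly_ne_zero {p : ℕ} [Fact p.Prime] {n a b : ℕ} (hab : a * b ≤ n) (hnb : n * b ≤ p)
    (c : Fin a × Fin b × Fin b → ZMod p) (hc : c ≠ 0) : stepanovPoly n a b c ≠ 0 := by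
  intro h
  apply hc
  -- The index j certifies b > 0, which gives a ≤ a * b ≤ n.
  have hlt : ∀ (i : Fin a) (j : Fin b), (i : ℕ) < n := fun i j =>
    lt_of_lt_of_le i.2 (le_trans (Nat.le_mul_of_pos_right a (Nat.pos_of_ne_zero fun h => by
      subst h; exact j.elim0)) hab)
  have hinj : Function.Injective (fun y : Fin a × Fin b => (y.1 : ℕ) + n * y.2) := by
    rintro ⟨i, j⟩ ⟨i', j'⟩ heq
    simp only at heq
    have h1 : (i : ℕ) = i' := by
      have := congrArg (· % n) heq
      simpa [Nat.mod_eq_of_lt (hlt i j), Nat.mod_eq_of_lt (hlt i' j)] using this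
    have hn : 0 < n := lt_of_le_of_lt (Nat.zero_le _) (hlt i j)
    have h2 : (j : ℕ) = j' := by
      have : n * (j : ℕ) = n * j' := by omega
      exact Nat.eq_of_mul_eq_mul_left hn this
    exact Prod.ext (Fin.ext h1) (Fin.ext h2)
  let P : ℕ → (ZMod p)[X] := fun l => if hl : l < b then
    ∑ y : Fin a × Fin b, monomial ((y.1 : ℕ) + n * y.2) (c (y.1, y.2, ⟨l, hl⟩)) else 0
  have hcoeff : ∀ (l : Fin b) (y : Fin a × Fin b),
      (P l).coeff ((y.1 : ℕ) + n * y.2) = c (y.1, y.2, l) := by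
    intro l y
    simp only [P, l.2, dif_pos, finsetSum_coeff, coeff_monomial]
    rw [Finset.sum_eq_single y]
    · simp
    · intro z _ hz
      rw [if_neg]
      exact fun he => hz (hinj he)
    · simp
  have hsupp : ∀ l, (P l).support ⊆
      Finset.univ.image (fun y : Fin a × Fin b => (y.1 : ℕ) + n * y.2) := by
    intro l e he
    by_contra hne
    rw [mem_support_iff] at he
    apply he
    simp only [P]
    split_ifs with hl
    · rw [finsetSum_coeff]
      refine Finset.sum_eq_zero fun y _ => ?_
      rw [coeff_monomial, if_neg]
      rintro rfl
      exact hne (Finset.mem_image_of_mem _ (Finset.mem_univ y))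
    · simp
  have hzero : ∀ l < b, P l = 0 := by
    apply eq_zero_of_sum_pow_mul_eq_zero ((1 - X : (ZMod p)[X]) ^ n)
    · apply pow_ne_zero
      intro h0
      have := congrArg (eval 0) h0
      simp at this
    · intro l hl hd
      apply eq_zero_of_X_sub_one_pow_dvd n
      · refine (Finset.card_le_card (hsupp l)).trans (Finset.card_image_le.trans ?_)
        simpa using hab
      · intro e he
        obtain ⟨y, -, rfl⟩ := Finset.mem_image.1 (hsupp l he)
        have h1 := hlt y.1 y.2
        have h2 : n * ((y.2 : ℕ) + 1) ≤ n * b := Nat.mul_le_mul_left n y.2.2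
        have h3 : n * ((y.2 : ℕ) + 1) = n * y.2 + n := by ring
        omega
      · have : (X - 1 : (ZMod p)[X]) ^ n ∣ (1 - X) ^ n :=
          pow_dvd_pow_of_dvd (by rw [← neg_sub, neg_dvd]) n
        exact this.trans hd
    · rw [← h, stepanovPoly, Finset.sum_range]
      simp only [P, Fin.is_lt, dif_pos, Finset.mul_sum]
      rw [Finset.sum_comm]
      simp only [Fintype.sum_prod_type]
      refine Finset.sum_congr rfl fun i _ => Finset.sum_congr rfl fun j _ =>
        Finset.sum_congr rfl fun l _ => ?_
      rw [← C_mul_X_pow_eq_monomial]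
      ring
  funext ⟨i, j, l⟩
  rw [← hcoeff l (i, j), hzero l l.2]
  simp

open Polynomial in
/-- The derivation `X (1 - X) d/dX`. -/
noncomputable def stepanovDeriv (K : Type*) [Field K] : K[X] →ₗ[K] K[X] :=
  LinearMap.mulLeft K (X * (1 - X)) ∘ₗ derivative

open Polynomial in
/-- The action of `stepanovDeriv` on the cofactor of `X ^ r * (1 - X) ^ s`. -/
noncomputable def twistedDeriv {K : Type*} [Field K] (r s : ℕ) (Q : K[X]) : K[X] :=
  X * (1 - X) * derivative Q + C (r : K) * (1 - X) * Q - C (s : K) * X * Q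

-- The factor X (1 - X) in the derivation restores the powers lost by differentiating X^r (1 - X)^s.
-- Only the cofactor changes, and its degree grows by at most one per step however large r and s
-- are.
open Polynomial in
theorem stepanovDeriv_mul {K : Type*} [Field K] (r s : ℕ) (Q : K[X]) :
    stepanovDeriv K (Q * (X ^ r * (1 - X) ^ s)) = twistedDeriv r s Q * (X ^ r * (1 - X) ^ s) := by
  have h1 : (X : K[X]) * derivative ((X : K[X]) ^ r) = C (r : K) * X ^ r := by
    cases r with
    | zero => simp
    | succ r => rw [derivative_X_pow]; simp; ring
  have h2 : (1 - X : K[X]) * derivative ((1 - X : K[X]) ^ s) = - (C (s : K) * (1 - X) ^ s) := by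
    cases s with
    | zero => simp
    | succ s => rw [derivative_pow]; simp; ring
  simp only [stepanovDeriv, twistedDeriv, LinearMap.comp_apply, LinearMap.mulLeft_apply,
    derivative_mul]
  linear_combination Q * (1 - X) * (1 - X) ^ s * h1 + Q * X ^ r * X * h2

open Polynomial in
theorem stepanovDeriv_iterate_mul {K : Type*} [Field K] (r s m : ℕ) (Q : K[X]) :
    (stepanovDeriv K)^[m] (Q * (X ^ r * (1 - X) ^ s)) =
      (twistedDeriv r s)^[m] Q * (X ^ r * (1 - X) ^ s) := by
  induction m generalizing Q with
  | zero => rfl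
  | succ m ih => rw [Function.iterate_succ_apply, Function.iterate_succ_apply, stepanovDeriv_mul, ih]

open Polynomial in
theorem natDegree_twistedDeriv_iterate_le {K : Type*} [Field K] (r s m : ℕ) (Q : K[X]) :
    ((twistedDeriv r s)^[m] Q).natDegree ≤ Q.natDegree + m := by
  have hstep : ∀ Q : K[X], (twistedDeriv r s Q).natDegree ≤ Q.natDegree + 1 := by
    intro Q
    have h1X : (1 - X : K[X]).natDegree ≤ 1 := by (compute_degree!)
    unfold twistedDeriv
    refine (natDegree_sub_le _ _).trans (max_le ((natDegree_add_le _ _).trans (max_le ?_ ?_)) ?_)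
    · by_cases hQ : Q.natDegree = 0
      · rw [natDegree_eq_zero] at hQ
        obtain ⟨x, rfl⟩ := hQ
        simp
      · have h3 := natDegree_derivative_lt (p := Q) hQ
        have h4 := natDegree_mul_le_of_le (natDegree_mul_le_of_le (natDegree_X_le (R := K)) h1X)
          (le_refl (derivative Q).natDegree)
        omega
    · have := natDegree_mul_le_of_le (natDegree_mul_le_of_le (natDegree_C (r : K)).le h1X)
        (le_refl Q.natDegree)
      omega
    · have := natDegree_mul_le_of_le (natDegree_mul_le_of_le (natDegree_C (s : K)).le
        (natDegree_X_le (R := K))) (le_refl Q.natDegree)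
      omega
  induction m generalizing Q with
  | zero => simp
  | succ m ih =>
    rw [Function.iterate_succ_apply]
    have := ih (twistedDeriv r s Q)
    have := hstep Q
    omega

-- At u ≠ 0, 1 the factor X (1 - X) is invertible, so the iterates detect multiplicity as ordinary
-- derivatives do; D ≤ p keeps the integer factors produced by differentiation nonzero mod p.
open Polynomial in
theorem X_sub_C_pow_dvd_of_iterate_eval_eq_zero {p : ℕ} [Fact p.Prime] {u : ZMod p} (h0 : u ≠ 0)
    (h1 : u ≠ 1) (D : ℕ) (hD : D ≤ p) (P : (ZMod p)[X])
    (hP : ∀ m < D, ((stepanovDeriv (ZMod p))^[m] P).eval u = 0) : (X - C u) ^ D ∣ P := by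
  induction D generalizing P with
  | zero => simp
  | succ D ih =>
    obtain ⟨G, rfl⟩ := ih (by omega) P fun m hm => hP m (by omega)
    have hd := ih (by omega) (stepanovDeriv (ZMod p) ((X - C u) ^ D * G)) fun m hm => by
      rw [← Function.iterate_succ_apply]
      exact hP (m + 1) (by omega)
    rcases Nat.eq_zero_or_pos D with rfl | hDpos
    · have := hP 0 (by omega)
      simpa [dvd_iff_isRoot] using this
    have hcop : IsCoprime ((X - C u) ^ D) (X * (1 - X) : (ZMod p)[X]) := by
      apply IsCoprime.pow_left
      rw [(irreducible_X_sub_C u).coprime_iff_not_dvd, dvd_iff_isRoot]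
      simp [h0, sub_eq_zero, h1.symm]
    have hd' : (X - C u) ^ D ∣ derivative ((X - C u) ^ D * G) := hcop.dvd_of_dvd_mul_left hd
    rw [derivative_mul, derivative_pow] at hd'
    have hd2 := (dvd_add_left (Dvd.intro (derivative G) rfl)).1 hd'
    obtain ⟨D, rfl⟩ : ∃ E, D = E + 1 := ⟨D - 1, by omega⟩
    rw [pow_succ (X - C u) (D + 1)]
    apply mul_dvd_mul_left
    have hne : (X - C u) ^ D ≠ 0 := pow_ne_zero _ (X_sub_C_ne_zero u)
    have hd3 : (X - C u) ^ D * (X - C u) ∣ (X - C u) ^ D * (C ((D + 1 : ℕ) : ZMod p) * G) := by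
      rw [← pow_succ]
      convert hd2 using 1
      simp
      ring
    have hd4 := (mul_dvd_mul_iff_left hne).1 hd3
    have hunit : ((D + 1 : ℕ) : ZMod p) ≠ 0 := by
      rw [Ne, ZMod.natCast_eq_zero_iff]
      exact Nat.not_dvd_of_pos_of_lt (by omega) (by omega)
    rw [dvd_iff_isRoot] at hd4 ⊢
    simpa [IsRoot, eval_mul, eval_C, -Nat.cast_add, hunit] using hd4

open Polynomial in
/-- **Stepanov's method** for the curves `u ^ n = y`, `(1 - u) ^ n = z`. -/
theorem stepanov_bound {p : ℕ} [Fact p.Prime] {n a b : ℕ} (ha : a ≤ n) (hab : a * b ≤ n)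
    (hnb : n * b ≤ p) (hap : a ≤ p) (T : Finset (ZMod p × ZMod p)) (U : Finset (ZMod p))
    (hU : ∀ u ∈ U, u ≠ 0 ∧ u ≠ 1 ∧ (u ^ n, (1 - u) ^ n) ∈ T) (hapos : 0 < a)
    (hcount : T.card * (2 * a) < b ^ 2) : U.card * a ≤ 2 * (n * b) := by
  -- At a point u with (u^n, (1 - u)^n) = (y, z), the m-th iterate equals, up to replacing the large
  -- powers by powers of y and z, a polynomial in u of degree below 2a. Killing its coefficients for
  -- all m < a and (y, z) ∈ T costs 2a²|T| linear conditions on ab² unknowns.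
  let L : (Fin a × Fin b × Fin b → ZMod p) →ₗ[ZMod p] (Fin a × T × Fin (2 * a) → ZMod p) :=
    Matrix.mulVecLin (Matrix.of fun y x =>
      ((twistedDeriv (n * x.2.1) (n * x.2.2))^[y.1] (X ^ (x.1 : ℕ) : (ZMod p)[X])).coeff y.2.2 *
        (y.2.1.1.1 ^ (x.2.1 : ℕ) * y.2.1.1.2 ^ (x.2.2 : ℕ)))
  have hker : LinearMap.ker L ≠ ⊥ := by
    apply LinearMap.ker_ne_bot_of_finrank_lt
    simp only [Module.finrank_fintype_fun_eq_card, Fintype.card_prod, Fintype.card_fin,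
      Fintype.card_coe]
    rw [← pow_two]
    exact Nat.mul_lt_mul_of_pos_left hcount hapos
  obtain ⟨c, hcker, hc⟩ := (Submodule.ne_bot_iff _).1 hker
  have hΨ := stepanovPoly_ne_zero hab hnb c hc
  have hdvd : ∀ u ∈ U, (X - C u) ^ a ∣ stepanovPoly n a b c := by
    intro u hu
    obtain ⟨h0, h1, hT⟩ := hU u hu
    apply X_sub_C_pow_dvd_of_iterate_eval_eq_zero h0 h1 a hap
    intro m hm
    have hrow : ∀ q : Fin (2 * a), ∑ x : Fin a × Fin b × Fin b,
        ((twistedDeriv (n * x.2.1) (n * x.2.2))^[m] (X ^ (x.1 : ℕ) : (ZMod p)[X])).coeff q *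
          ((u ^ n) ^ (x.2.1 : ℕ) * ((1 - u) ^ n) ^ (x.2.2 : ℕ)) * c x = 0 := fun q =>
      congrFun (LinearMap.mem_ker.1 hcker) (⟨m, hm⟩, ⟨_, hT⟩, q)
    have hexp : ((stepanovDeriv (ZMod p))^[m] (stepanovPoly n a b c)).eval u =
        ∑ x : Fin a × Fin b × Fin b, ∑ q : Fin (2 * a), u ^ (q : ℕ) *
        (((twistedDeriv (n * x.2.1) (n * x.2.2))^[m] (X ^ (x.1 : ℕ) : (ZMod p)[X])).coeff q *
          ((u ^ n) ^ (x.2.1 : ℕ) * ((1 - u) ^ n) ^ (x.2.2 : ℕ)) * c x) := by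
      rw [stepanovPoly, ← Module.End.pow_apply, map_sum, eval_finsetSum]
      refine Finset.sum_congr rfl fun x _ => ?_
      rw [← smul_eq_C_mul, map_smul, Module.End.pow_apply, stepanovDeriv_iterate_mul, eval_smul,
        eval_mul, eval_eq_sum_range' (n := 2 * a), Finset.sum_range, Finset.sum_mul,
        Finset.smul_sum]
      · refine Finset.sum_congr rfl fun q _ => ?_
        simp only [eval_mul, eval_pow, eval_X, eval_sub, eval_one, smul_eq_mul, pow_mul]
        ring
      · refine lt_of_le_of_lt (natDegree_twistedDeriv_iterate_le _ _ _ _) ?_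
        have := x.1.2
        rw [natDegree_X_pow]
        omega
    rw [hexp, Finset.sum_comm]
    refine Finset.sum_eq_zero fun q _ => ?_
    rw [← Finset.mul_sum, hrow q, mul_zero]
  have hprod : ∏ u ∈ U, (X - C u) ^ a ∣ stepanovPoly n a b c := by
    refine Finset.prod_dvd_of_coprime (fun u _ v _ huv => ?_) hdvd
    exact (isCoprime_X_sub_C_of_isUnit_sub (sub_ne_zero.2 huv).isUnit).pow
  have hdeg := natDegree_le_of_dvd hprod hΨ
  rw [natDegree_prod_of_monic _ _ fun u _ => (monic_X_sub_C u).pow a] at hdeg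
  simp only [natDegree_pow, natDegree_X_sub_C, mul_one, Finset.sum_const, smul_eq_mul] at hdeg
  refine hdeg.trans ?_
  apply natDegree_sum_le_of_forall_le
  intro x _
  have h1X : (1 - X : (ZMod p)[X]).natDegree ≤ 1 := by (compute_degree!)
  have h1 := natDegree_mul_le_of_le (natDegree_C (c x)).le (natDegree_mul_le_of_le
    (natDegree_X_pow_le (R := ZMod p) (x.1 : ℕ)) (natDegree_mul_le_of_le
      (natDegree_X_pow_le (R := ZMod p) (n * x.2.1)) (natDegree_pow_le_of_le (n * x.2.2) h1X)))
  refine h1.trans ?_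
  have h2 : n * ((x.2.1 : ℕ) + 1) ≤ n * b := Nat.mul_le_mul_left n x.2.1.2
  have h3 : n * ((x.2.2 : ℕ) + 1) ≤ n * b := Nat.mul_le_mul_left n x.2.2.2
  have h4 := x.1.2
  rw [mul_add] at h2 h3
  omega

/-- Optimising the parameters in Stepanov's method. -/
theorem stepanov_card_pow_le {p : ℕ} [Fact p.Prime] {n : ℕ} (hn : n ^ 2 < p)
    (T : Finset (ZMod p × ZMod p)) (hT : 8 * T.card ≤ n ^ 2) (U : Finset (ZMod p))
    (hU : ∀ u ∈ U, u ≠ 0 ∧ u ≠ 1 ∧ (u ^ n, (1 - u) ^ n) ∈ T) :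
    U.card ^ 6 ≤ 2 ^ 21 * (n * T.card) ^ 4 := by
  rcases Nat.eq_zero_or_pos T.card with h0 | hk
  · have : U = ∅ := by
      rw [Finset.card_eq_zero] at h0
      subst h0
      exact Finset.eq_empty_of_forall_notMem fun u hu => by simpa using (hU u hu).2.2
    simp [this]
  set k := T.card with hkdef
  have hnpos : 0 < n := by
    rcases Nat.eq_zero_or_pos n with rfl | h
    · omega
    · exact h
  -- The count needs b² > 2ka, so b ≈ √(ka); then ab ≤ n permits a of order (n²/k)^{1/3}. The
  -- largest such a is taken, as the bound 2nb/a decreases in a.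
  obtain ⟨a, ha1, ha2⟩ : ∃ a, 8 * k * a ^ 3 ≤ n ^ 2 ∧ n ^ 2 < 8 * k * (a + 1) ^ 3 := by
    let f := Nat.findGreatest (fun a => 8 * k * a ^ 3 ≤ n ^ 2) (n ^ 2)
    refine ⟨f, Nat.findGreatest_spec (P := fun a => 8 * k * a ^ 3 ≤ n ^ 2) (Nat.zero_le _)
      (by simp), ?_⟩
    by_contra! hcon
    have hle : f + 1 ≤ n ^ 2 := by
      refine le_trans ?_ hcon
      calc f + 1 ≤ (f + 1) ^ 3 := Nat.le_self_pow (by norm_num) _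
        _ ≤ 8 * k * (f + 1) ^ 3 := Nat.le_mul_of_pos_left _ (by omega)
    have := Nat.le_findGreatest (P := fun a => 8 * k * a ^ 3 ≤ n ^ 2) hle hcon
    omega
  have hapos : 0 < a := by
    rcases Nat.eq_zero_or_pos a with rfl | h
    · simp at ha2
      omega
    · exact h
  obtain ⟨b, hb1, hb2⟩ : ∃ b, 2 * k * a < b ^ 2 ∧ b ^ 2 ≤ 8 * k * a := by
    refine ⟨Nat.sqrt (2 * k * a) + 1, Nat.lt_succ_sqrt' _, ?_⟩
    have h1 := Nat.sqrt_le' (2 * k * a)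
    have h2 : 1 ≤ Nat.sqrt (2 * k * a) := Nat.sqrt_pos.2 (by positivity)
    nlinarith
  have hab : a * b ≤ n := by
    rw [← Nat.pow_le_pow_iff_left (n := 2) (by norm_num)]
    calc (a * b) ^ 2 = a ^ 2 * b ^ 2 := by ring
      _ ≤ a ^ 2 * (8 * k * a) := Nat.mul_le_mul_left _ hb2
      _ = 8 * k * a ^ 3 := by ring
      _ ≤ n ^ 2 := ha1
  have hbpos : 0 < b := by
    rcases Nat.eq_zero_or_pos b with rfl | h
    · simp at hb1
    · exact h
  have han : a ≤ n := (Nat.le_mul_of_pos_right a hbpos).trans hab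
  have hnp : n ≤ p := (Nat.le_self_pow (by norm_num) n).trans hn.le
  have hnb : n * b ≤ p := by
    rw [← Nat.pow_le_pow_iff_left (n := 6) (by norm_num)]
    calc (n * b) ^ 6 = n ^ 6 * (b ^ 2) ^ 3 := by ring
      _ ≤ n ^ 6 * (8 * k * a) ^ 3 := by gcongr
      _ = n ^ 6 * ((8 * k) ^ 2 * (8 * k * a ^ 3)) := by ring
      _ ≤ n ^ 6 * ((n ^ 2) ^ 2 * n ^ 2) := by gcongr
      _ = (n ^ 2) ^ 6 := by ring
      _ ≤ p ^ 6 := by gcongr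
  have key := stepanov_bound han hab hnb (han.trans hnp) T U hU hapos
    (by rw [← hkdef]; linarith)
  set M := U.card
  have h1 : M ^ 2 * a ≤ 32 * (n ^ 2 * k) := by
    refine Nat.le_of_mul_le_mul_right (c := a) ?_ hapos
    calc M ^ 2 * a * a = (M * a) ^ 2 := by ring
      _ ≤ (2 * (n * b)) ^ 2 := by gcongr
      _ = 4 * n ^ 2 * b ^ 2 := by ring
      _ ≤ 4 * n ^ 2 * (8 * k * a) := by gcongr
      _ = 32 * (n ^ 2 * k) * a := by ring
  have h2 : n ^ 2 ≤ 64 * k * a ^ 3 := by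
    calc n ^ 2 ≤ 8 * k * (a + 1) ^ 3 := ha2.le
      _ ≤ 8 * k * (a + a) ^ 3 := by gcongr; omega
      _ = 64 * k * a ^ 3 := by ring
  -- The extra factor n² is traded for 64ka³, which turns M^6 into (M² a)³ and eliminates a.
  refine Nat.le_of_mul_le_mul_right (c := n ^ 2) ?_ (by positivity)
  calc M ^ 6 * n ^ 2 ≤ M ^ 6 * (64 * k * a ^ 3) := by gcongr
    _ = 64 * k * (M ^ 2 * a) ^ 3 := by ring
    _ ≤ 64 * k * (32 * (n ^ 2 * k)) ^ 3 := by gcongr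
    _ = 2 ^ 21 * (n * k) ^ 4 * n ^ 2 := by ring

/-! ### Level sets and third moment of the power classes -/

/-- The `n`-th roots of unity in `ZMod p`. -/
def unityRoots (p n : ℕ) [Fact p.Prime] : Finset (ZMod p) :=
  Finset.univ.filter fun x => x ^ n = 1

/-- The `u ≠ 0, 1` whose `n`-th power class, together with that of `1 - u`, is `κ`. -/
def powClass {p : ℕ} [Fact p.Prime] (n : ℕ) (κ : ZMod p × ZMod p) : Finset (ZMod p) :=
  Finset.univ.filter fun u => u ≠ 0 ∧ u ≠ 1 ∧ (u ^ n, (1 - u) ^ n) = κ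

theorem card_filter_pow_eq_le {p : ℕ} [Fact p.Prime] {n : ℕ} (hn : 0 < n) (y : ZMod p) :
    (Finset.univ.filter fun x : ZMod p => x ^ n = y).card ≤ n := by
  classical
  refine le_trans (Finset.card_le_card (t := (Polynomial.nthRoots n y).toFinset) ?_)
    ((Multiset.toFinset_card_le _).trans (Polynomial.card_nthRoots n y))
  intro x hx
  rw [Multiset.mem_toFinset, Polynomial.mem_nthRoots hn]
  simpa using hx

theorem card_unityRoots_le {p : ℕ} [Fact p.Prime] {n : ℕ} (hn : 0 < n) :
    (unityRoots p n).card ≤ n :=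
  card_filter_pow_eq_le hn 1

theorem card_powClass_le {p : ℕ} [Fact p.Prime] {n : ℕ} (hn : 0 < n) (κ : ZMod p × ZMod p) :
    (powClass n κ).card ≤ n := by
  refine le_trans (Finset.card_le_card ?_) (card_filter_pow_eq_le hn κ.1)
  intro u hu
  simp only [powClass, Finset.mem_filter, Finset.mem_univ, true_and] at hu ⊢
  rw [← hu.2.2]

/-- Two points u ≠ v of one class give two roots of unity u/v and (1 - u)/(1 - v), and these two
quotients determine u and v. -/
theorem sum_card_offDiag_powClass_le {p : ℕ} [Fact p.Prime] {n : ℕ} (hn : 0 < n)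
    (T : Finset (ZMod p × ZMod p)) : ∑ κ ∈ T, (powClass n κ).offDiag.card ≤ n ^ 2 := by
  rw [← Finset.card_sigma, sq]
  refine le_trans ?_ (Nat.mul_le_mul (card_unityRoots_le (p := p) hn) (card_unityRoots_le (p := p) hn))
  rw [← Finset.card_product]
  apply Finset.card_le_card_of_injOn (fun w => (w.2.1 / w.2.2, (1 - w.2.1) / (1 - w.2.2)))
  · rintro ⟨κ, u, v⟩ hw
    simp only [Finset.coe_sigma, Set.mem_sigma_iff, Finset.mem_coe, Finset.mem_offDiag, powClass,
      Finset.mem_filter, Finset.mem_univ, true_and] at hw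
    obtain ⟨-, ⟨hu0, hu1, hu⟩, ⟨hv0, hv1, hv⟩, -⟩ := hw
    rw [← hv, Prod.mk.injEq] at hu
    have hv1' : 1 - v ≠ 0 := sub_ne_zero.2 hv1.symm
    simp only [Finset.coe_product, Set.mem_prod, Finset.mem_coe, unityRoots, Finset.mem_filter,
      Finset.mem_univ, true_and, div_pow, hu.1, hu.2]
    exact ⟨div_self (pow_ne_zero _ hv0), div_self (pow_ne_zero _ hv1')⟩
  · rintro ⟨κ, u, v⟩ hw ⟨κ', u', v'⟩ hw' heq
    simp only [Finset.coe_sigma, Set.mem_sigma_iff, Finset.mem_coe, Finset.mem_offDiag, powClass,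
      Finset.mem_filter, Finset.mem_univ, true_and] at hw hw'
    obtain ⟨-, ⟨hu0, hu1, hu⟩, ⟨hv0, hv1, hv⟩, huv⟩ := hw
    obtain ⟨-, ⟨hu0', hu1', hu'⟩, ⟨hv0', hv1', hv'⟩, huv'⟩ := hw'
    simp only [Prod.mk.injEq] at heq
    obtain ⟨h1, h2⟩ := heq
    rw [div_eq_div_iff hv0 hv0'] at h1
    rw [div_eq_div_iff (sub_ne_zero.2 hv1.symm) (sub_ne_zero.2 hv1'.symm)] at h2
    have h3 : (u - v) * (v - v') = 0 := by linear_combination -(1 - v) * h1 - v * h2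
    have h4 : v = v' := sub_eq_zero.1 ((mul_eq_zero.1 h3).resolve_left (sub_ne_zero.2 huv))
    subst h4
    have h5 : u = u' := mul_right_cancel₀ hv0 h1
    subst h5
    have h6 : κ = κ' := by rw [← hu, ← hu']
    rw [h6]

/-- With k rich classes, their union has at least kt points, so Stepanov gives (kt)^6 ≤ 2^21 (nk)^4,
that is k t³ = O(n²). The elementary pair count supplies the condition 8k ≤ n² when t ≥ 4 and
settles t = 3 by itself. -/
theorem card_level_mul_cube_le {p : ℕ} [Fact p.Prime] {n : ℕ} (hn : 0 < n) (hnp : n ^ 2 < p) {t : ℕ}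
    (ht : 3 ≤ t) :
    (Finset.univ.filter fun κ : ZMod p × ZMod p => t ≤ (powClass n κ).card).card * t ^ 3
      ≤ 2 ^ 11 * n ^ 2 := by
  classical
  set T := Finset.univ.filter fun κ : ZMod p × ZMod p => t ≤ (powClass n κ).card with hT
  have hTmem : ∀ κ ∈ T, t ≤ (powClass n κ).card := fun κ hκ => by simpa [hT] using hκ
  have hpair : T.card * (t * (t - 1)) ≤ n ^ 2 := by
    refine le_trans ?_ (sum_card_offDiag_powClass_le hn T)
    rw [← smul_eq_mul, ← Finset.sum_const]
    refine Finset.sum_le_sum fun κ hκ => ?_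
    rw [Finset.offDiag_card, ← Nat.mul_sub_one]
    exact Nat.mul_le_mul (hTmem κ hκ) (Nat.sub_le_sub_right (hTmem κ hκ) 1)
  rcases ht.eq_or_lt with rfl | ht4
  · norm_num at hpair ⊢
    omega
  have h12 : T.card * (4 * 3) ≤ n ^ 2 :=
    le_trans (Nat.mul_le_mul_left _ (Nat.mul_le_mul ht4 (by omega))) hpair
  have hstep := stepanov_card_pow_le hnp T (by omega) (T.biUnion (powClass n)) (by
    intro u hu
    obtain ⟨κ, hκ, hu⟩ := Finset.mem_biUnion.1 hu
    simp only [powClass, Finset.mem_filter, Finset.mem_univ, true_and] at hu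
    exact ⟨hu.1, hu.2.1, hu.2.2 ▸ hκ⟩)
  have hcard : T.card * t ≤ (T.biUnion (powClass n)).card := by
    rw [Finset.card_biUnion]
    · rw [← smul_eq_mul, ← Finset.sum_const]
      exact Finset.sum_le_sum hTmem
    · intro κ _ κ' _ hne
      rw [Function.onFun, Finset.disjoint_left]
      intro u hu hu'
      simp only [powClass, Finset.mem_filter, Finset.mem_univ, true_and] at hu hu'
      exact hne (hu.2.2.symm.trans hu'.2.2)
  have hfin := (Nat.pow_le_pow_left hcard 6).trans hstep
  rcases Nat.eq_zero_or_pos T.card with h0 | hk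
  · simp [h0]
  rw [← Nat.pow_le_pow_iff_left (n := 2) (by norm_num)]
  refine Nat.le_of_mul_le_mul_right (c := T.card ^ 4) ?_ (by positivity)
  calc (T.card * t ^ 3) ^ 2 * T.card ^ 4 = (T.card * t) ^ 6 := by ring
    _ ≤ 2 ^ 21 * (n * T.card) ^ 4 := hfin
    _ ≤ 2 ^ 22 * (n * T.card) ^ 4 := by gcongr <;> norm_num
    _ = (2 ^ 11 * n ^ 2) ^ 2 * T.card ^ 4 := by ring

/-- Summation by parts: this form turns a third moment into a weighted sum of level-set sizes. -/
theorem descFactorial_three_eq_sum (r : ℕ) :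
    r.descFactorial 3 = ∑ s ∈ Finset.range r, 3 * (s * (s - 1)) := by
  induction r with
  | zero => rfl
  | succ r ih =>
    rw [Finset.sum_range_succ, ← ih]
    rcases r with _ | _ | r
    · rfl
    · rfl
    · simp [Nat.descFactorial]
      ring

theorem sum_descFactorial_powClass_le {p : ℕ} [Fact p.Prime] {n : ℕ} (hn : 0 < n)
    (hnp : n ^ 2 < p) :
    ((∑ κ : ZMod p × ZMod p, (powClass n κ).card.descFactorial 3 : ℕ) : ℝ)
      ≤ 6144 * n ^ 2 * Real.log n := by
  have hswap : ∑ κ : ZMod p × ZMod p, (powClass n κ).card.descFactorial 3 =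
      ∑ s ∈ Finset.range n, 3 * (s * (s - 1)) *
        (Finset.univ.filter fun κ : ZMod p × ZMod p => s + 1 ≤ (powClass n κ).card).card := by
    have h1 : ∀ κ : ZMod p × ZMod p, (powClass n κ).card.descFactorial 3 =
        ∑ s ∈ Finset.range n, if s + 1 ≤ (powClass n κ).card then 3 * (s * (s - 1)) else 0 := by
      intro κ
      rw [descFactorial_three_eq_sum, ← Finset.sum_filter]
      refine Finset.sum_congr ?_ fun _ _ => rfl
      ext s
      have := card_powClass_le hn κ
      simp only [Finset.mem_range, Finset.mem_filter]
      omega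
    simp only [h1]
    rw [Finset.sum_comm]
    refine Finset.sum_congr rfl fun s _ => ?_
    rw [← Finset.sum_filter, Finset.sum_const, smul_eq_mul, mul_comm]
  -- The constant is 3 * 2^11. The weight vanishes at s = 0, so the harmonic term 1 can be removed
  -- there; the sum is then at most log n with no additive constant.
  have hterm : ∀ s : ℕ, ((3 * (s * (s - 1)) *
      (Finset.univ.filter fun κ : ZMod p × ZMod p => s + 1 ≤ (powClass n κ).card).card : ℕ) : ℝ)
      ≤ 6144 * n ^ 2 * (((s : ℝ) + 1)⁻¹ - if s = 0 then 1 else 0) := by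
    intro s
    rcases s with _ | _ | s
    · simp
    · simp
    · have hlev := card_level_mul_cube_le hn hnp (t := s + 1 + 1 + 1) (by omega)
      set k := (Finset.univ.filter fun κ : ZMod p × ZMod p =>
        s + 1 + 1 + 1 ≤ (powClass n κ).card).card
      have hlev' : (k : ℝ) * ((s : ℝ) + 3) ^ 3 ≤ 2 ^ 11 * n ^ 2 := by
        have : (k : ℝ) * ((s : ℝ) + 1 + 1 + 1) ^ 3 ≤ 2 ^ 11 * n ^ 2 := by exact_mod_cast hlev
        convert this using 3
        ring
      simp only [Nat.add_sub_cancel, Nat.add_eq_zero_iff, one_ne_zero, and_false, if_false, sub_zero]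
      push_cast
      have hpos : (0 : ℝ) < (s : ℝ) + 1 + 1 + 1 := by positivity
      rw [← div_eq_mul_inv, le_div_iff₀ hpos]
      calc 3 * (((s : ℝ) + 1 + 1) * ((s : ℝ) + 1)) * k * ((s : ℝ) + 1 + 1 + 1)
          ≤ 3 * (((s : ℝ) + 3) * ((s : ℝ) + 3)) * k * ((s : ℝ) + 3) := by
            have h1 : (s : ℝ) + 1 + 1 ≤ s + 3 := by linarith
            have h2 : (s : ℝ) + 1 ≤ s + 3 := by linarith
            have h3 : (s : ℝ) + 1 + 1 + 1 ≤ s + 3 := by linarith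
            gcongr
        _ = 3 * (k * ((s : ℝ) + 3) ^ 3) := by ring
        _ ≤ 3 * (2 ^ 11 * n ^ 2) := by gcongr
        _ = 6144 * n ^ 2 := by ring
  rw [hswap, Nat.cast_sum]
  refine (Finset.sum_le_sum fun s _ => hterm s).trans ?_
  rw [← Finset.mul_sum]
  gcongr
  rw [Finset.sum_sub_distrib, Finset.sum_ite_eq' (Finset.range n) 0, if_pos (Finset.mem_range.2 hn)]
  have := harmonic_le_one_add_log n
  simp only [harmonic, Rat.cast_sum, Rat.cast_inv, Rat.cast_natCast, Rat.cast_add, Rat.cast_one,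
    Nat.cast_add, Nat.cast_one] at this
  linarith

/-! ### Collinear triples in the grid of roots of unity -/

/-- The abscissae of the points of `unityRoots × unityRoots` on the line `y = λ x + μ`. -/
def linePoints (p n : ℕ) [Fact p.Prime] (l : ZMod p × ZMod p) : Finset (ZMod p) :=
  (unityRoots p n).filter fun a => l.1 * a + l.2 ∈ unityRoots p n

/-- For a point (x, y) on y = λx + μ put u = y/μ; then 1 - u = -(λ/μ)x, and the n-th powers of both
depend on the line alone. -/
theorem card_linePoints_le {p n : ℕ} [Fact p.Prime] (hn : 0 < n) {l : ZMod p × ZMod p}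
    (h1 : l.1 ≠ 0) (h2 : l.2 ≠ 0) :
    (linePoints p n l).card ≤ (powClass n (l.2⁻¹ ^ n, (-(l.1 / l.2)) ^ n)).card := by
  have hid : ∀ a, 1 - (l.1 * a + l.2) / l.2 = -(l.1 / l.2) * a := by
    intro a
    field_simp
    ring
  apply Finset.card_le_card_of_injOn (fun a => (l.1 * a + l.2) / l.2)
  · intro a ha
    simp only [linePoints, unityRoots, Finset.coe_filter, Finset.mem_filter, Finset.mem_univ,
      true_and, Set.mem_ofPred_eq] at ha
    have hne : ∀ x : ZMod p, x ^ n = 1 → x ≠ 0 := by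
      rintro x hx rfl
      rw [zero_pow hn.ne'] at hx
      exact zero_ne_one hx
    simp only [powClass, Finset.coe_filter, Finset.mem_univ, true_and, Set.mem_ofPred_eq]
    refine ⟨div_ne_zero (hne _ ha.2) h2, fun h => ?_, ?_⟩
    · have := hid a
      rw [h, sub_self, eq_comm] at this
      exact mul_ne_zero (neg_ne_zero.2 (div_ne_zero h1 h2)) (hne _ ha.1) this
    · rw [hid, mul_pow, ha.1, div_pow, ha.2, mul_one, one_div, inv_pow]
  · intro a _ b _ hab
    have := (div_left_inj' h2).1 hab
    exact mul_left_cancel₀ h1 (add_right_cancel this)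

/-- A line through the origin that meets the grid has a root of unity as slope, so these contribute
at most n · n³. Any other line is determined by 1/μ and -λ/μ, whose n-th powers are prescribed by κ,
so each class arises from at most n² lines. -/
theorem sum_descFactorial_linePoints_le {p n : ℕ} [Fact p.Prime] (hn : 0 < n) :
    ∑ l ∈ Finset.univ.filter (fun l : ZMod p × ZMod p => l.1 ≠ 0),
      (linePoints p n l).card.descFactorial 3 ≤
    n ^ 4 + n ^ 2 * ∑ κ : ZMod p × ZMod p, (powClass n κ).card.descFactorial 3 := by
  classical
  rw [← Finset.sum_filter_add_sum_filter_not _ (fun l : ZMod p × ZMod p => l.2 = 0)]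
  refine Nat.add_le_add ?_ ?_
  · calc _ ≤ ∑ l ∈ (unityRoots p n).image (fun x => (x, (0 : ZMod p))),
          (linePoints p n l).card.descFactorial 3 := by
          refine Finset.sum_le_sum_of_ne_zero fun l hl hne => ?_
          simp only [Finset.mem_filter, Finset.mem_univ, true_and] at hl
          have hne' : (linePoints p n l).Nonempty := by
            rw [Finset.nonempty_iff_ne_empty]
            intro h
            simp [h] at hne
          obtain ⟨a, ha⟩ := hne'
          simp only [linePoints, unityRoots, Finset.mem_filter, Finset.mem_univ, true_and, hl.2,
            add_zero, mul_pow] at ha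
          refine Finset.mem_image.2 ⟨l.1, ?_, Prod.ext rfl hl.2.symm⟩
          simpa [unityRoots, ha.1] using ha.2
      _ ≤ ∑ l ∈ (unityRoots p n).image (fun x => (x, (0 : ZMod p))), n ^ 3 := by
          refine Finset.sum_le_sum fun l _ => ?_
          refine (Nat.descFactorial_le_pow _ _).trans (Nat.pow_le_pow_left ?_ 3)
          exact (Finset.card_filter_le _ _).trans (card_unityRoots_le hn)
      _ ≤ n * n ^ 3 := by
          rw [Finset.sum_const, smul_eq_mul]
          exact Nat.mul_le_mul_right _ (Finset.card_image_le.trans (card_unityRoots_le hn))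
      _ = n ^ 4 := by ring
  · set S := (Finset.univ.filter (fun l : ZMod p × ZMod p => l.1 ≠ 0)).filter (fun l => ¬ l.2 = 0)
      with hS
    have hSmem : ∀ l ∈ S, l.1 ≠ 0 ∧ l.2 ≠ 0 := fun l hl => by simpa [hS] using hl
    calc ∑ l ∈ S, (linePoints p n l).card.descFactorial 3
        ≤ ∑ l ∈ S, (powClass n (l.2⁻¹ ^ n, (-(l.1 / l.2)) ^ n)).card.descFactorial 3 :=
          Finset.sum_le_sum fun l hl => Nat.descFactorial_le 3
            (card_linePoints_le hn (hSmem l hl).1 (hSmem l hl).2)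
      _ = ∑ κ : ZMod p × ZMod p, ∑ l ∈ S with (l.2⁻¹ ^ n, (-(l.1 / l.2)) ^ n) = κ,
            (powClass n (l.2⁻¹ ^ n, (-(l.1 / l.2)) ^ n)).card.descFactorial 3 :=
          (Finset.sum_fiberwise _ _ _).symm
      _ ≤ ∑ κ : ZMod p × ZMod p, n ^ 2 * (powClass n κ).card.descFactorial 3 := by
          refine Finset.sum_le_sum fun κ _ => ?_
          rw [Finset.sum_congr rfl (g := fun _ => (powClass n κ).card.descFactorial 3) fun l hl => by
            rw [(Finset.mem_filter.1 hl).2], Finset.sum_const, smul_eq_mul]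
          refine Nat.mul_le_mul_right _ ?_
          rw [sq]
          refine le_trans ?_ (Nat.mul_le_mul (card_filter_pow_eq_le hn κ.1)
            (card_filter_pow_eq_le hn κ.2))
          rw [← Finset.card_product]
          apply Finset.card_le_card_of_injOn (fun l => (l.2⁻¹, -(l.1 / l.2)))
          · intro l hl
            have := (Finset.mem_filter.1 (Finset.mem_coe.1 hl)).2
            simp [← this]
          · intro l hl l' hl' heq
            have h0 := hSmem l (Finset.mem_filter.1 (Finset.mem_coe.1 hl)).1
            simp only [Prod.mk.injEq, inv_inj, neg_inj] at heq
            obtain ⟨h2, h1⟩ := heq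
            rw [← h2] at h1
            exact Prod.ext ((div_left_inj' h0.2).1 h1) h2
      _ = _ := (Finset.mul_sum _ _ _).symm

/-! ### Simple ratios and Cauchy–Schwarz -/

/-- The ordered triples of distinct elements of `S`. -/
def distinctTriples {α : Type*} [DecidableEq α] (S : Finset α) : Finset ((α × α) × α) :=
  (S.offDiag ×ˢ S).filter fun x => x.2 ≠ x.1.1 ∧ x.2 ≠ x.1.2

theorem mem_distinctTriples {α : Type*} [DecidableEq α] {S : Finset α} {a b c : α} :
    ((a, b), c) ∈ distinctTriples S ↔ (a ∈ S ∧ b ∈ S ∧ c ∈ S) ∧ a ≠ b ∧ c ≠ a ∧ c ≠ b := by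
  simp only [distinctTriples, Finset.mem_filter, Finset.mem_product, Finset.mem_offDiag]
  tauto

theorem card_distinctTriples {α : Type*} [DecidableEq α] (S : Finset α) :
    (distinctTriples S).card = S.card.descFactorial 3 := by
  have h : ∀ x ∈ S.offDiag, (∑ c ∈ S, if c ≠ x.1 ∧ c ≠ x.2 then 1 else 0) = S.card - 2 := by
    intro x hx
    rw [Finset.mem_offDiag] at hx
    rw [← Finset.sum_filter, ← Finset.card_eq_sum_ones]
    have : S.filter (fun c => c ≠ x.1 ∧ c ≠ x.2) = (S.erase x.1).erase x.2 := by
      ext c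
      simp only [Finset.mem_filter, Finset.mem_erase]
      tauto
    rw [this, Finset.card_erase_of_mem (Finset.mem_erase.2 ⟨hx.2.2.symm, hx.2.1⟩),
      Finset.card_erase_of_mem hx.1]
    omega
  rw [distinctTriples, Finset.card_filter, Finset.sum_product, Finset.sum_congr rfl h,
    Finset.sum_const, Finset.offDiag_card, smul_eq_mul, ← Nat.mul_sub_one]
  simp [Nat.descFactorial]
  ring

/-- Cauchy–Schwarz for the simple ratios of a set of roots of unity. -/
theorem descFactorial_sq_le_card_mul_sum {p n : ℕ} [Fact p.Prime] (B : Finset (ZMod p))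
    (hB : B ⊆ unityRoots p n) (R : Finset (ZMod p))
    (hR : ∀ a ∈ B, ∀ b ∈ B, ∀ c ∈ B, a ≠ b → c ≠ a → c ≠ b → (b - a) / (c - a) ∈ R) :
    (B.card.descFactorial 3) ^ 2 ≤ R.card *
      ∑ l ∈ Finset.univ.filter (fun l : ZMod p × ZMod p => l.1 ≠ 0),
        (linePoints p n l).card.descFactorial 3 := by
  let f : (ZMod p × ZMod p) × ZMod p → ZMod p := fun x => (x.1.2 - x.1.1) / (x.2 - x.1.1)
  have hmaps : Set.MapsTo f (distinctTriples B) R := by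
    rintro ⟨⟨a, b⟩, c⟩ hx
    obtain ⟨⟨ha, hb, hc⟩, hab, hca, hcb⟩ := mem_distinctTriples.1 (Finset.mem_coe.1 hx)
    exact hR a ha b hb c hc hab hca hcb
  rw [← card_distinctTriples, Finset.card_eq_sum_card_fiberwise hmaps]
  refine sq_sum_le_card_mul_sum_sq.trans (Nat.mul_le_mul_left _ ?_)
  simp only [← card_distinctTriples]
  rw [← Finset.card_sigma]
  have hsq : ∀ r, ((distinctTriples B).filter (fun x => f x = r)).card ^ 2 =
      (((distinctTriples B).filter (fun x => f x = r)) ×ˢ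
        ((distinctTriples B).filter (fun x => f x = r))).card := fun r => by
    rw [Finset.card_product, sq]
  simp only [hsq]
  rw [← Finset.card_sigma]
  -- Triples with equal ratio are matched by a unique affine map, of nonzero slope; its graph is the
  -- line, and the first triple gives the abscissae of three distinct grid points on it.
  let slope : ((ZMod p × ZMod p) × ZMod p) × ((ZMod p × ZMod p) × ZMod p) → ZMod p :=
    fun w => (w.2.1.2 - w.2.1.1) / (w.1.1.2 - w.1.1.1)
  have hline : ∀ a b c a' b' c' : ZMod p, a ≠ b → c ≠ a → a' ≠ b' → c' ≠ a' →
      (b - a) / (c - a) = (b' - a') / (c' - a') → ∀ s, s = (b' - a') / (b - a) →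
      b' = s * b + (a' - s * a) ∧ c' = s * c + (a' - s * a) := by
    intro a b c a' b' c' hab hca hab' hca' h s hs
    have e1 : b - a ≠ 0 := sub_ne_zero.2 hab.symm
    have e2 : c - a ≠ 0 := sub_ne_zero.2 hca
    have e3 : c' - a' ≠ 0 := sub_ne_zero.2 hca'
    rw [div_eq_div_iff e2 e3] at h
    rw [eq_div_iff e1] at hs
    refine ⟨by linear_combination -hs, ?_⟩
    apply mul_left_cancel₀ e1
    linear_combination h - (c - a) * hs
  apply Finset.card_le_card_of_injOn (fun w => ⟨(slope w.2, w.2.2.1.1 - slope w.2 * w.2.1.1.1), w.2.1⟩)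
  · rintro ⟨r, ⟨⟨a, b⟩, c⟩, ⟨⟨a', b'⟩, c'⟩⟩ hw
    simp only [Finset.coe_sigma, Set.mem_sigma_iff, Finset.mem_coe, Finset.mem_product,
      Finset.mem_filter, mem_distinctTriples, f] at hw
    obtain ⟨-, ⟨⟨⟨ha, hb, hc⟩, hab, hca, hcb⟩, hr⟩, ⟨⟨ha', hb', hc'⟩, hab', hca', hcb'⟩, hr'⟩ := hw
    obtain ⟨e1, e2⟩ := hline a b c a' b' c' hab hca hab' hca' (hr.trans hr'.symm) _ rfl
    simp only [Finset.coe_sigma, Set.mem_sigma_iff, Finset.mem_coe, Finset.mem_filter,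
      Finset.mem_univ, true_and, mem_distinctTriples, linePoints, slope]
    refine ⟨div_ne_zero (sub_ne_zero.2 hab'.symm) (sub_ne_zero.2 hab.symm),
      ⟨⟨hB ha, ?_⟩, ⟨hB hb, ?_⟩, ⟨hB hc, ?_⟩⟩, hab, hca, hcb⟩
    · rw [add_sub_cancel]
      exact hB ha'
    · rw [← e1]
      exact hB hb'
    · rw [← e2]
      exact hB hc'
  · rintro ⟨r, ⟨⟨a, b⟩, c⟩, ⟨⟨a', b'⟩, c'⟩⟩ hw ⟨r₂, ⟨⟨a₂, b₂⟩, c₂⟩, ⟨⟨a₂', b₂'⟩, c₂'⟩⟩ hw₂ heq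
    simp only [Finset.coe_sigma, Set.mem_sigma_iff, Finset.mem_coe, Finset.mem_product,
      Finset.mem_filter, mem_distinctTriples, f] at hw hw₂
    obtain ⟨-, ⟨⟨-, hab, hca, -⟩, hr⟩, ⟨⟨-, hab', hca', -⟩, hr'⟩⟩ := hw
    obtain ⟨-, ⟨⟨-, hab₂, hca₂, -⟩, hr₂⟩, ⟨⟨-, hab₂', hca₂', -⟩, hr₂'⟩⟩ := hw₂
    simp only [Sigma.mk.injEq, Prod.mk.injEq, heq_eq_eq, slope] at heq
    obtain ⟨⟨hs, hi⟩, ⟨rfl, rfl⟩, rfl⟩ := heq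
    obtain ⟨e1, e2⟩ := hline a b c a' b' c' hab hca hab' hca' (hr.trans hr'.symm) _ rfl
    obtain ⟨e3, e4⟩ := hline a b c a₂' b₂' c₂' hab₂ hca₂ hab₂' hca₂' (hr₂.trans hr₂'.symm) _ rfl
    have ha : a' = a₂' := by
      rw [hs] at hi
      exact sub_left_injective hi
    have hb : b' = b₂' := by rw [e1, e3, hs, ha]
    have hc : c' = c₂' := by rw [e2, e4, hs, ha]
    have hrr : r = r₂ := hr.symm.trans hr₂
    rw [ha, hb, hc, hrr]

/-! ### Second moment of point–line incidences -/

/-- The points of `P` on the line `y = λ x + μ`. -/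
def incidentPoints {p : ℕ} (P : Finset (ZMod p × ZMod p)) (l : ZMod p × ZMod p) :
    Finset (ZMod p × ZMod p) :=
  P.filter fun x => x.2 = l.1 * x.1 + l.2

theorem card_lines_through {p : ℕ} [Fact p.Prime] (x : ZMod p × ZMod p) :
    (Finset.univ.filter fun l : ZMod p × ZMod p => x.2 = l.1 * x.1 + l.2).card = p := by
  classical
  have : (Finset.univ.filter fun l : ZMod p × ZMod p => x.2 = l.1 * x.1 + l.2) =
      Finset.univ.image fun s : ZMod p => (s, x.2 - s * x.1) := by
    ext l
    simp only [Finset.mem_filter, Finset.mem_univ, true_and, Finset.mem_image]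
    constructor
    · intro h
      exact ⟨l.1, Prod.ext rfl (by simp [h])⟩
    · rintro ⟨s, rfl⟩
      simp
  rw [this, Finset.card_image_of_injective _ fun s t h => (Prod.mk.inj h).1, Finset.card_univ,
    ZMod.card]

theorem card_lines_through_two_le {p : ℕ} [Fact p.Prime] (x y : ZMod p × ZMod p) (hxy : x ≠ y) :
    (Finset.univ.filter fun l : ZMod p × ZMod p =>
      x.2 = l.1 * x.1 + l.2 ∧ y.2 = l.1 * y.1 + l.2).card ≤ 1 := by
  rw [Finset.card_le_one]
  intro l hl m hm
  simp only [Finset.mem_filter, Finset.mem_univ, true_and] at hl hm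
  have hne : x.1 - y.1 ≠ 0 := by
    rw [sub_ne_zero]
    intro h
    exact hxy (Prod.ext h (by rw [hl.1, hl.2, h]))
  have h1 : l.1 = m.1 := by
    apply mul_right_cancel₀ hne
    linear_combination hl.2 - hl.1 + hm.1 - hm.2
  exact Prod.ext h1 (by linear_combination hm.1 - hl.1 - x.1 * h1)

theorem sum_card_incidentPoints {p : ℕ} [Fact p.Prime] (P : Finset (ZMod p × ZMod p)) :
    ∑ l, (incidentPoints P l).card = P.card * p := by
  simp only [incidentPoints, Finset.card_filter]
  rw [Finset.sum_comm]
  simp only [← Finset.card_filter, card_lines_through, Finset.sum_const, smul_eq_mul]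

theorem sum_card_incidentPoints_sq_le {p : ℕ} [Fact p.Prime] (P : Finset (ZMod p × ZMod p)) :
    ∑ l, (incidentPoints P l).card ^ 2 ≤ P.card * p + P.card ^ 2 := by
  have h1 : ∀ l, (incidentPoints P l).card ^ 2 = ∑ x ∈ P, ∑ y ∈ P,
      if x.2 = l.1 * x.1 + l.2 ∧ y.2 = l.1 * y.1 + l.2 then 1 else 0 := by
    intro l
    rw [incidentPoints, Finset.card_filter, sq, Finset.sum_mul_sum]
    refine Finset.sum_congr rfl fun x _ => Finset.sum_congr rfl fun y _ => ?_
    rw [ite_and]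
    split_ifs <;> simp
  have h2 : ∀ x ∈ P, ∀ y ∈ P, (Finset.univ.filter fun l : ZMod p × ZMod p =>
      x.2 = l.1 * x.1 + l.2 ∧ y.2 = l.1 * y.1 + l.2).card ≤ (if x = y then p else 0) + 1 := by
    intro x _ y _
    split_ifs with h
    · subst h
      simp only [and_self]
      rw [card_lines_through]
      omega
    · simpa using card_lines_through_two_le x y h
  simp only [h1]
  rw [Finset.sum_comm]
  refine (Finset.sum_le_sum (g := fun x => ∑ y ∈ P, ((if x = y then p else 0) + 1))
    fun x hx => ?_).trans ?_
  · rw [Finset.sum_comm]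
    simp only [← Finset.card_filter]
    exact Finset.sum_le_sum fun y hy => h2 x hx y hy
  simp only [Finset.sum_add_distrib, Finset.sum_ite_eq, Finset.sum_const, smul_eq_mul, mul_one]
  rw [Finset.sum_congr rfl fun x hx => if_pos hx, Finset.sum_const, smul_eq_mul, sq]

/-- A variance bound: |P|/p is the mean incidence over the p² non-vertical lines, and since two
distinct points share at most one of them, the |P|² terms cancel. -/
theorem sum_sq_card_incidentPoints_sub_le {p : ℕ} [Fact p.Prime] (P : Finset (ZMod p × ZMod p)) :
    ∑ l, (((incidentPoints P l).card : ℝ) - P.card / p) ^ 2 ≤ p * P.card := by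
  have hp : (p : ℝ) ≠ 0 := Nat.cast_ne_zero.2 (Fact.out : p.Prime).ne_zero
  have h1 : ∑ l, ((incidentPoints P l).card : ℝ) = P.card * p := by
    exact_mod_cast sum_card_incidentPoints P
  have h2 : ∑ l, ((incidentPoints P l).card : ℝ) ^ 2 ≤ P.card * p + (P.card : ℝ) ^ 2 := by
    exact_mod_cast sum_card_incidentPoints_sq_le P
  simp only [sub_sq, Finset.sum_add_distrib, Finset.sum_sub_distrib, Finset.sum_const,
    Finset.card_univ, Fintype.card_prod, ZMod.card, nsmul_eq_mul, ← Finset.sum_mul,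
    ← Finset.mul_sum, h1]
  have h3 : 2 * ((P.card : ℝ) * p) * (P.card / p) = 2 * (P.card : ℝ) ^ 2 := by
    field_simp
  have h4 : ((p * p : ℕ) : ℝ) * ((P.card : ℝ) / p) ^ 2 = (P.card : ℝ) ^ 2 := by
    push_cast
    field_simp
  rw [h3, h4]
  linarith

/-! ### Subgroups as sets, and the size of Γ ∩ (1 - Γ) -/

section subgroupSet

variable {p : ℕ} [Fact p.Prime] {H : Subgroup (ZMod p)ˣ} {x y : ZMod p}

theorem ne_zero_of_mem_subgroupSet (hx : x ∈ subgroupSet H) : x ≠ 0 := by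
  obtain ⟨u, -, rfl⟩ := hx
  exact u.ne_zero

theorem mul_mem_subgroupSet (hx : x ∈ subgroupSet H) (hy : y ∈ subgroupSet H) :
    x * y ∈ subgroupSet H := by
  obtain ⟨u, hu, rfl⟩ := hx
  obtain ⟨v, hv, rfl⟩ := hy
  exact ⟨u * v, H.mul_mem hu hv, by simp⟩

theorem div_mem_subgroupSet (hx : x ∈ subgroupSet H) (hy : y ∈ subgroupSet H) :
    x / y ∈ subgroupSet H := by
  obtain ⟨u, hu, rfl⟩ := hx
  obtain ⟨v, hv, rfl⟩ := hy
  exact ⟨u / v, H.div_mem hu hv, by simp⟩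

theorem ncard_subgroupSet (H : Subgroup (ZMod p)ˣ) : (subgroupSet H).ncard = Nat.card H := by
  rw [subgroupSet, Set.ncard_image_of_injective _ Units.val_injective, ← Nat.card_coe_set_eq]
  rfl

theorem pow_ncard_eq_one (hx : x ∈ subgroupSet H) : x ^ (subgroupSet H).ncard = 1 := by
  obtain ⟨u, hu, rfl⟩ := hx
  rw [ncard_subgroupSet]
  have : (⟨u, hu⟩ : H) ^ Nat.card H = 1 := pow_card_eq_one'
  have hu' : u ^ Nat.card H = 1 := congrArg Subtype.val this
  simp only [← Units.val_pow_eq_pow_val, hu', Units.val_one]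

theorem ncard_subgroupSet_pos (H : Subgroup (ZMod p)ˣ) : 0 < (subgroupSet H).ncard := by
  rw [ncard_subgroupSet]
  exact Nat.card_pos

/-- Quotients of differences of a set with `S - S ⊆ ξ Γ ∪ {0}` lie in `Γ`. -/
theorem DiffSubset.div_mem {S : Set (ZMod p)} {ξ : (ZMod p)ˣ} (h : DiffSubset S ξ H)
    {a b c d : ZMod p} (ha : a ∈ S) (hb : b ∈ S) (hc : c ∈ S) (hd : d ∈ S) (hab : a ≠ b)
    (hcd : c ≠ d) : (a - b) / (c - d) ∈ subgroupSet H := by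
  have key : ∀ x ∈ S, ∀ y ∈ S, x ≠ y → ∃ g ∈ subgroupSet H, x - y = ξ * g := by
    intro x hx y hy hxy
    rcases h (Set.sub_mem_sub hx hy) with h | h
    · obtain ⟨g, hg, hgx⟩ := h
      exact ⟨g, hg, by simpa using hgx.symm⟩
    · exact absurd (sub_eq_zero.1 h) hxy
  obtain ⟨g, hg, e1⟩ := key a ha b hb hab
  obtain ⟨g', hg', e2⟩ := key c hc d hd hcd
  rw [e1, e2, mul_div_mul_left _ _ ξ.ne_zero]
  exact div_mem_subgroupSet hg hg'

end subgroupSet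

open Classical in
/-- `Γ ∩ (1 - Γ)`. -/
noncomputable def unitSums {p : ℕ} [Fact p.Prime] (H : Subgroup (ZMod p)ˣ) : Finset (ZMod p) :=
  Finset.univ.filter fun x => x ∈ subgroupSet H ∧ 1 - x ∈ subgroupSet H

/-- For g, h in the subgroup, x ↦ (gx, h(1 - x)) places every solution on the line of slope -h/g and
intercept h. Thus |Γ|² distinct lines are all at least this rich in Γ × Γ, and the variance bound
limits their common excess to √p. -/
theorem card_unitSums_le {p : ℕ} [Fact p.Prime] (H : Subgroup (ZMod p)ˣ) :
    ((unitSums H).card : ℝ) ≤ ((subgroupSet H).ncard : ℝ) ^ 2 / p + √p := by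
  classical
  set G : Finset (ZMod p) := Finset.univ.filter fun x => x ∈ subgroupSet H with hG
  have hGmem : ∀ x, x ∈ G ↔ x ∈ subgroupSet H := fun x => by simp [hG]
  have hGcard : (subgroupSet H).ncard = G.card := by
    rw [← Set.ncard_coe_finset]
    congr 1
    ext x
    simp [hG]
  have hGpos : 0 < G.card := hGcard ▸ ncard_subgroupSet_pos H
  rw [hGcard]
  by_contra! hcon
  set P := G ×ˢ G with hP
  have hPcard : (P.card : ℝ) = (G.card : ℝ) ^ 2 := by rw [hP, Finset.card_product]; push_cast; ring
  have hinc : ∀ w ∈ P, (unitSums H).card ≤ (incidentPoints P (-(w.2 / w.1), w.2)).card := by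
    rintro ⟨g, h⟩ hw
    rw [hP, Finset.mem_product, hGmem, hGmem] at hw
    have hg0 := ne_zero_of_mem_subgroupSet hw.1
    apply Finset.card_le_card_of_injOn (fun x => (g * x, h * (1 - x)))
    · intro x hx
      have hx' : x ∈ subgroupSet H ∧ 1 - x ∈ subgroupSet H := by simpa [unitSums] using hx
      rw [Finset.mem_coe, incidentPoints, Finset.mem_filter, hP, Finset.mem_product, hGmem, hGmem]
      refine ⟨⟨mul_mem_subgroupSet hw.1 hx'.1, mul_mem_subgroupSet hw.2 hx'.2⟩, ?_⟩
      simp only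
      field_simp
      ring
    · intro x _ y _ hxy
      exact mul_left_cancel₀ hg0 (Prod.mk.inj hxy).1
  have hinj : Set.InjOn (fun w : ZMod p × ZMod p => (-(w.2 / w.1), w.2)) P := by
    rintro ⟨g, h⟩ hw ⟨g', h'⟩ hw' heq
    simp only [hP, Finset.coe_product, Set.mem_prod, Finset.mem_coe, hGmem] at hw hw'
    simp only [Prod.mk.injEq, neg_inj] at heq
    obtain ⟨h1, rfl⟩ := heq
    rw [div_eq_mul_inv, div_eq_mul_inv] at h1
    rw [inv_injective (mul_left_cancel₀ (ne_zero_of_mem_subgroupSet hw.2) h1)]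
  have hsub : (G.card : ℝ) ^ 2 * ((unitSums H).card - (G.card : ℝ) ^ 2 / p) ^ 2 ≤
      p * (G.card : ℝ) ^ 2 := by
    rw [← hPcard]
    refine le_trans ?_ (sum_sq_card_incidentPoints_sub_le P)
    refine le_trans ?_ (Finset.sum_le_univ_sum_of_nonneg
      (s := P.image fun w => (-(w.2 / w.1), w.2)) fun l => sq_nonneg _)
    rw [Finset.sum_image hinj, ← nsmul_eq_mul, ← Finset.sum_const]
    refine Finset.sum_le_sum fun w hw => ?_
    have h1 : ((unitSums H).card : ℝ) ≤ (incidentPoints P (-(w.2 / w.1), w.2)).card := by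
      exact_mod_cast hinc w hw
    have h2 : 0 ≤ ((unitSums H).card : ℝ) - P.card / p := by
      rw [hPcard]
      linarith [Real.sqrt_nonneg (p : ℝ)]
    gcongr
  have hsq : ((unitSums H).card - (G.card : ℝ) ^ 2 / p) ^ 2 ≤ (p : ℝ) := by
    have : (0 : ℝ) < (G.card : ℝ) ^ 2 := by positivity
    refine le_of_mul_le_mul_left ?_ this
    linarith
  linarith [Real.le_sqrt_of_sq_le hsq]

/-! ### Assembly of the two estimates -/

theorem two_mul_pow_three_le_descFactorial {m : ℕ} (hm : 3 ≤ m) :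
    2 * m ^ 3 ≤ 9 * m.descFactorial 3 := by
  obtain ⟨r, rfl⟩ := Nat.exists_eq_add_of_le' hm
  have : (r + 3).descFactorial 3 = (r + 1) * ((r + 2) * (r + 3)) := by
    simp [Nat.descFactorial]
  rw [this]
  nlinarith [Nat.zero_le (r ^ 3), Nat.zero_le (r ^ 2)]

theorem mul_sqrt_le_sq_of_rpow_le {x y : ℝ} (hx : 0 ≤ x) (h : x ^ (3 / 4 : ℝ) ≤ y) :
    x * √x ≤ y ^ 2 := by
  calc x * √x = (x ^ (3 / 4 : ℝ)) ^ 2 := by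
        rw [← Real.rpow_natCast, ← Real.rpow_mul hx, Real.sqrt_eq_rpow]
        nth_rewrite 1 [← Real.rpow_one x]
        rw [← Real.rpow_add_of_nonneg hx (by norm_num) (by norm_num)]
        norm_num
    _ ≤ y ^ 2 := by gcongr

/-- The estimate for subsets of shifts of a subgroup. -/
theorem ncard_pow_six_le {p : ℕ} [Fact p.Prime] (A Γ : Subgroup (ZMod p)ˣ) (ξ : (ZMod p)ˣ)
    (hΓ : (p : ℝ) ^ (3 / 4 : ℝ) ≤ ((subgroupSet Γ).ncard : ℝ)) (A' : Set (ZMod p)) (s : ZMod p)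
    (hA' : A' ⊆ subgroupSet A + {s}) (hdiff : DiffSubset A' ξ Γ)
    (h2 : 2 ≤ (subgroupSet A).ncard) (hlt : ((subgroupSet A).ncard : ℝ) < √(p : ℝ)) :
    (A'.ncard : ℝ) ^ 6 ≤ 300000 * (((subgroupSet A).ncard : ℝ) ^ 4 *
      Real.logb 2 ((subgroupSet A).ncard : ℝ) * ((subgroupSet Γ).ncard : ℝ) ^ 2 / (p : ℝ)) := by
  classical
  have hp1 : (1 : ℝ) ≤ p := by exact_mod_cast (Fact.out : p.Prime).one_lt.le
  have hp0 : (0 : ℝ) < p := by linarith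
  have hg := mul_sqrt_le_sq_of_rpow_le hp0.le hΓ
  have hNle := card_unitSums_le Γ
  have hpow : ∀ x ∈ subgroupSet A, x ^ (subgroupSet A).ncard = 1 := fun x hx => pow_ncard_eq_one hx
  set n := (subgroupSet A).ncard
  set g : ℝ := ((subgroupSet Γ).ncard : ℝ)
  have hn2 : (2 : ℝ) ≤ n := by exact_mod_cast h2
  have hnp : n ^ 2 < p := by
    have : (n : ℝ) ^ 2 < p := (Real.lt_sqrt (by positivity)).1 hlt
    exact_mod_cast this
  have hlog1 : 1 ≤ Real.logb 2 n := by
    rw [Real.le_logb_iff_rpow_le (by norm_num) (by linarith)]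
    simpa using hn2
  have hlogle : Real.log n ≤ Real.logb 2 n := by
    rw [Real.logb, le_div_iff₀ (Real.log_pos (by norm_num))]
    have h0 : 0 ≤ Real.log n := Real.log_nonneg (by linarith)
    nlinarith [Real.log_two_lt_d9]
  -- Here |Γ| ≥ p^{3/4} enters: it says exactly that √p ≤ |Γ|²/p.
  have hN : ((unitSums Γ).card : ℝ) ≤ 2 * (g ^ 2 / p) := by
    have : √(p : ℝ) ≤ g ^ 2 / p := by
      rw [le_div_iff₀ hp0]
      linarith
    linarith
  set B : Finset (ZMod p) := Finset.univ.filter fun x => x + s ∈ A' with hB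
  have hBmem : ∀ x, x ∈ B ↔ x + s ∈ A' := fun x => by simp [hB]
  have hBcard : A'.ncard = B.card := by
    rw [← Set.ncard_coe_finset, ← Set.ncard_image_of_injective (B : Set (ZMod p))
      (add_left_injective s)]
    congr 1
    ext x
    constructor
    · intro hx
      exact ⟨x - s, by simpa [hB] using hx, by simp⟩
    · rintro ⟨y, hy, rfl⟩
      exact (hBmem y).1 hy
  have hBsub : B ⊆ unityRoots p n := by
    intro x hx
    obtain ⟨y, hy, z, hz, hyz⟩ := hA' ((hBmem x).1 hx)
    rw [Set.mem_singleton_iff] at hz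
    have hxy : y = x := by
      rw [hz] at hyz
      exact add_right_cancel hyz
    simpa [unityRoots, ← hxy] using hpow y hy
  have hCS := descFactorial_sq_le_card_mul_sum B hBsub (unitSums Γ) (by
    intro a ha b hb c hc hab hca hcb
    rw [hBmem] at ha hb hc
    have hne : ∀ {x y : ZMod p}, x ≠ y → x + s ≠ y + s := fun h h' => h (add_right_cancel h')
    have e1 := hdiff.div_mem hb ha hc ha (hne hab.symm) (hne hca)
    have e2 := hdiff.div_mem hc hb hc ha (hne hcb) (hne hca)
    rw [add_sub_add_right_eq_sub, add_sub_add_right_eq_sub] at e1 e2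
    have e3 : 1 - (b - a) / (c - a) = (c - b) / (c - a) := by
      have : c - a ≠ 0 := sub_ne_zero.2 hca
      field_simp
      ring
    rw [unitSums, Finset.mem_filter, e3]
    exact ⟨Finset.mem_univ _, e1, e2⟩)
  have hnpos : 0 < n := by omega
  have hlines := sum_descFactorial_linePoints_le (p := p) hnpos
  have hsum := sum_descFactorial_powClass_le (p := p) hnpos hnp
  rw [hBcard]
  set m := B.card
  set Sκ := ∑ κ : ZMod p × ZMod p, (powClass n κ).card.descFactorial 3
  set Sl := ∑ l ∈ Finset.univ.filter (fun l : ZMod p × ZMod p => l.1 ≠ 0),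
    (linePoints p n l).card.descFactorial 3
  set L := Real.logb 2 (n : ℝ)
  have hX : (n : ℝ) ^ 4 * L * g ^ 2 / p = (n : ℝ) ^ 4 * L * (g ^ 2 / p) := by ring
  rw [hX]
  have hgp : 1 ≤ g ^ 2 / p := by
    rw [le_div_iff₀ hp0]
    have : 1 ≤ √(p : ℝ) := Real.one_le_sqrt.2 hp1
    nlinarith
  -- With fewer than three points there are no triples, but then m^6 ≤ 64 while the right side is at
  -- least 300000.
  rcases Nat.lt_or_ge m 3 with hm | hm
  · have hm6 : (m : ℝ) ^ 6 ≤ 2 ^ 6 := by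
      have : (m : ℝ) ≤ 2 := by exact_mod_cast Nat.le_of_lt_succ hm
      gcongr
    have hn4 : (1 : ℝ) ≤ (n : ℝ) ^ 4 := one_le_pow₀ (by linarith)
    have h1 : 1 ≤ (n : ℝ) ^ 4 * L := one_le_mul_of_one_le_of_one_le hn4 hlog1
    have h3 : 1 ≤ (n : ℝ) ^ 4 * L * (g ^ 2 / p) := one_le_mul_of_one_le_of_one_le h1 hgp
    linarith
  · have hdesc : 2 * (m : ℝ) ^ 3 ≤ 9 * (m.descFactorial 3 : ℝ) := by
      exact_mod_cast two_mul_pow_three_le_descFactorial hm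
    have hCS' : (m.descFactorial 3 : ℝ) ^ 2 ≤ (unitSums Γ).card * (Sl : ℝ) := by exact_mod_cast hCS
    have hlines' : (Sl : ℝ) ≤ (n : ℝ) ^ 4 + (n : ℝ) ^ 2 * (Sκ : ℝ) := by exact_mod_cast hlines
    have hSl : (Sl : ℝ) ≤ 6145 * ((n : ℝ) ^ 4 * L) := by
      calc (Sl : ℝ) ≤ (n : ℝ) ^ 4 + (n : ℝ) ^ 2 * (Sκ : ℝ) := hlines'
        _ ≤ (n : ℝ) ^ 4 * L + (n : ℝ) ^ 2 * (6144 * n ^ 2 * L) := by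
          gcongr
          · exact le_mul_of_one_le_right (by positivity) hlog1
          · exact hsum.trans (by gcongr)
        _ = 6145 * ((n : ℝ) ^ 4 * L) := by ring
    have hprod : ((unitSums Γ).card : ℝ) * Sl ≤ 2 * (g ^ 2 / p) * (6145 * ((n : ℝ) ^ 4 * L)) := by
      gcongr
    have hsq : (2 * (m : ℝ) ^ 3) ^ 2 ≤ (9 * (m.descFactorial 3 : ℝ)) ^ 2 := by gcongr
    have hnn : 0 ≤ (n : ℝ) ^ 4 * L * (g ^ 2 / p) := by positivity
    -- The constants combine to 4 m^6 ≤ 81 · 2 · 6145 times the main term, and 81 · 2 · 6145 / 4 <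
    -- 300000.
    nlinarith

/-- If |S|² > p, then for every unit v the map (x, y) ↦ x + vy has a collision on S × S, which
writes v as a quotient of differences of S and so puts it in Γ. -/
theorem ncard_sq_le_of_diffSubset {p : ℕ} [Fact p.Prime] {S : Set (ZMod p)}
    {Γ : Subgroup (ZMod p)ˣ} {ξ : (ZMod p)ˣ} (hΓ : Γ ≠ ⊤) (hdiff : DiffSubset S ξ Γ) :
    S.ncard ^ 2 ≤ p := by
  classical
  by_contra! hcon
  apply hΓ
  rw [Subgroup.eq_top_iff']
  intro v
  set B : Finset (ZMod p) := Finset.univ.filter fun x => x ∈ S with hB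
  have hBmem : ∀ x, x ∈ B ↔ x ∈ S := fun x => by simp [hB]
  have hBcard : S.ncard = B.card := by
    rw [← Set.ncard_coe_finset]
    congr 1
    ext x
    simp [hB]
  have hcard : (Finset.univ : Finset (ZMod p)).card < (B ×ˢ B).card := by
    rw [Finset.card_univ, ZMod.card, Finset.card_product, ← sq, ← hBcard]
    exact hcon
  obtain ⟨x, hx, y, hy, hxy, heq⟩ := Finset.exists_ne_map_eq_of_card_lt_of_maps_to hcard
    (f := fun w : ZMod p × ZMod p => w.1 + v * w.2) fun _ _ => Finset.mem_coe.2 (Finset.mem_univ _)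
  rw [Finset.mem_product, hBmem, hBmem] at hx hy
  have h2 : x.2 ≠ y.2 := by
    intro h
    simp only [h, add_left_inj] at heq
    exact hxy (Prod.ext heq h)
  have hv : (v : ZMod p) = (y.1 - x.1) / (x.2 - y.2) := by
    rw [eq_div_iff (sub_ne_zero.2 h2)]
    linear_combination heq
  have h1 : y.1 ≠ x.1 := by
    intro h
    rw [h, sub_self, zero_div] at hv
    exact v.ne_zero hv
  obtain ⟨w, hw, hwv⟩ := hdiff.div_mem hy.1 hx.1 hx.2 hy.2 h1 h2
  rw [← hv] at hwv
  rwa [← Units.ext hwv]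

theorem mainTheorem2 :
    ∃ C : ℝ, 0 < C ∧
      ∀ (p : ℕ) (_ : p.Prime) (A Γ : Subgroup (ZMod p)ˣ) (ξ : (ZMod p)ˣ),
        (p : ℝ) ^ (3 / 4 : ℝ) ≤ ((subgroupSet Γ).ncard : ℝ) →
        (Γ ≠ ⊤ → DiffSubset (subgroupSet A) ξ Γ →
          ((subgroupSet A).ncard : ℝ) ≤
            C * min (((subgroupSet Γ).ncard : ℝ) * (Real.logb 2 p) ^ (1 / 2 : ℝ) / √(p : ℝ))
              (√(p : ℝ))) ∧
        (∀ (A' : Set (ZMod p)) (s : ZMod p),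
          A' ⊆ subgroupSet A + {s} → DiffSubset A' ξ Γ →
          2 ≤ (subgroupSet A).ncard → ((subgroupSet A).ncard : ℝ) < √(p : ℝ) →
          (A'.ncard : ℝ) ^ 6 ≤
            C * (((subgroupSet A).ncard : ℝ) ^ 4 * Real.logb 2 ((subgroupSet A).ncard : ℝ) *
              ((subgroupSet Γ).ncard : ℝ) ^ 2 / (p : ℝ))) := by
  refine ⟨300000, by norm_num, fun p hprime A Γ ξ hΓ => ?_⟩
  have : Fact p.Prime := ⟨hprime⟩
  refine ⟨fun htop hdiff => ?_, ncard_pow_six_le A Γ ξ hΓ⟩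
  have hp2 : (2 : ℝ) ≤ p := by exact_mod_cast hprime.two_le
  have hp0 : (0 : ℝ) < p := by linarith
  have hsqrt : ((subgroupSet A).ncard : ℝ) ≤ √(p : ℝ) :=
    Real.le_sqrt_of_sq_le (by exact_mod_cast ncard_sq_le_of_diffSubset htop hdiff)
  have hlt : ((subgroupSet A).ncard : ℝ) < √(p : ℝ) := by
    refine lt_of_le_of_ne hsqrt fun h => ?_
    have h1 : ((subgroupSet A).ncard : ℝ) ^ 2 = p := by rw [h, Real.sq_sqrt hp0.le]
    have h3 : (subgroupSet A).ncard ^ 2 = p := by exact_mod_cast h1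
    exact hprime.prime.irreducible.not_isSquare ⟨(subgroupSet A).ncard, by rw [← sq]; exact h3.symm⟩
  have hg := mul_sqrt_le_sq_of_rpow_le hp0.le hΓ
  have hlogp : 1 ≤ Real.logb 2 p := by
    rw [Real.le_logb_iff_rpow_le (by norm_num) hp0]
    simpa using hp2
  have hsix := ncard_pow_six_le A Γ ξ hΓ (subgroupSet A) 0 (by simp) hdiff
  have hnpos := ncard_subgroupSet_pos A
  set n := (subgroupSet A).ncard
  set g : ℝ := ((subgroupSet Γ).ncard : ℝ)
  have hg0 : 0 ≤ g := Nat.cast_nonneg _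
  have hnpos' : (0 : ℝ) < n := by exact_mod_cast hnpos
  have hsq : (n : ℝ) ^ 2 ≤ 300000 * (Real.logb 2 p * (g ^ 2 / p)) := by
    -- For n = 1 the six-power estimate is unavailable (its logarithm would be 0); there log p and
    -- |Γ|²/p are both at least 1.
    rcases Nat.lt_or_ge n 2 with h1 | h2
    · have hn1 : n = 1 := by omega
      have hgp : 1 ≤ g ^ 2 / p := by
        rw [le_div_iff₀ hp0]
        have : 1 ≤ √(p : ℝ) := Real.one_le_sqrt.2 (by linarith)
        nlinarith
      have := one_le_mul_of_one_le_of_one_le hlogp hgp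
      rw [hn1]
      norm_num
      linarith
    · have h6 := hsix h2 hlt
      have hlog : Real.logb 2 n ≤ Real.logb 2 p := by
        apply Real.logb_le_logb_of_le (by norm_num) hnpos'
        refine hsqrt.trans ?_
        rw [Real.sqrt_le_left hp0.le]
        nlinarith
      refine le_of_mul_le_mul_left ?_ (pow_pos hnpos' 4)
      calc (n : ℝ) ^ 4 * (n : ℝ) ^ 2 = (n : ℝ) ^ 6 := by ring
        _ ≤ 300000 * ((n : ℝ) ^ 4 * Real.logb 2 n * g ^ 2 / p) := h6
        _ ≤ 300000 * ((n : ℝ) ^ 4 * Real.logb 2 p * g ^ 2 / p) := by gcongr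
        _ = (n : ℝ) ^ 4 * (300000 * (Real.logb 2 p * (g ^ 2 / p))) := by ring
  rw [mul_min_of_nonneg _ _ (by norm_num), le_min_iff]
  constructor
  · rw [← Real.sqrt_eq_rpow]
    refine (sq_le_sq₀ hnpos'.le (by positivity)).1 ?_
    have hnn : 0 ≤ Real.logb 2 p * (g ^ 2 / p) := by positivity
    calc (n : ℝ) ^ 2 ≤ 300000 * (Real.logb 2 p * (g ^ 2 / p)) := hsq
      -- Squaring the constant is wasteful but lets the same C serve both parts after taking roots.
      _ ≤ 300000 ^ 2 * (Real.logb 2 p * (g ^ 2 / p)) := by gcongr; norm_num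
      _ = (300000 * (g * √(Real.logb 2 p) / √p)) ^ 2 := by
        rw [mul_pow, div_pow, mul_pow, Real.sq_sqrt (by linarith), Real.sq_sqrt hp0.le]
        ring
  · linarith [Real.sqrt_nonneg (p : ℝ)]
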